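/- For an integer $k\ge 1$ and positive even integers $i_1,\dots,i_k$ the series \[ \zeta(i_1,\dots,i_k)=\sum_{n_1>\dots>n_k\ge 1}\frac1{n_1^{i_1}\cdots n_k^{i_k}} \] converges. For $n\ge k\ge 1$ let $E(2n,k)$ be the sum of $\zeta(i_1,\dots,i_k)$ over all $k$-tuples $(i_1,\dots,i_k)$ of positive even integers with $i_1+\dots+i_k=2n$. Then the generating function \[ F(t,s)=1+\sum_{n\ge k\ge 1}E(2n,k)\,t^n s^k \] satisfies \[ F(t,s)=\frac{\sin\bigl(\pi\sqrt{1-s}\,\sqrt{t}\bigr)}{\sqrt{1-s}\,\sin\bigl(\pi\sqrt{t}\bigr)} \] in both of the following senses. (a) As formal power series: let $\sqrt{1-s}=\sum_{m\ge 0}\binom{1/2}{m}(-s)^m\in\mathbb{R}[[s]]$ and write $t=u^2$, $\sqrt t=u$. In the integral domain $\mathbb{R}[[s]][[u]]$ we have $\sqrt{1-s}\,\sin(\pi u)\ne 0$ and $F(u^2,s)\cdot\sqrt{1-s}\,\sin(\pi u)=\sin(\pi\sqrt{1-s}\,u)$. (b) As functions: for all complex $t,s$ with $|t|<1$ the double series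 defining $F(t,s)$ converges absolutely, and if moreover $t\ne 0$ and $s\ne 1$, then for every choice of the complex square roots $\sqrt t$ and $\sqrt{1-s}$ the denominator $\sqrt{1-s}\,\sin(\pi\sqrt t)$ is nonzero and the displayed identity holds. -/

import Mathlib

open PowerSeries

/-- The index set of the multiple zeta series: `n₁ > n₂ > ⋯ > n_k ≥ 1`. -/
def MZVIndex (k : ℕ) : Type :=
  {n : Fin k → ℕ // StrictAnti n ∧ ∀ j, 1 ≤ n j}

/-- The general term `1 / (n₁ ^ i₁ ⋯ n_k ^ i_k)` of the multiple zeta series. -/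
noncomputable def mzvTerm {k : ℕ} (i : Fin k → ℕ) (n : MZVIndex k) : ℝ :=
  1 / ∏ j, (n.1 j : ℝ) ^ i j

/-- The multiple zeta value `ζ(i₁, …, i_k)`. -/
noncomputable def mzv {k : ℕ} (i : Fin k → ℕ) : ℝ :=
  ∑' n : MZVIndex k, mzvTerm i n

/-- The `k`-tuples of positive even integers with sum `w`. -/
def evenArguments (w k : ℕ) : Finset (Fin k → ℕ) :=
  {i ∈ Finset.piAntidiag Finset.univ w | ∀ j, 0 < i j ∧ Even (i j)}

/-- `E(w, k)`: the sum of all multiple zeta values of even arguments, weight `w` and depth `k`. -/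
noncomputable def evenMZVSum (w k : ℕ) : ℝ :=
  ∑ i ∈ evenArguments w k, mzv i

/-- The pairs `(n, k)` with `n ≥ k ≥ 1`. -/
def GenIndex : Type := {p : ℕ × ℕ // 1 ≤ p.2 ∧ p.2 ≤ p.1}

/-- The term `E(2n, k) tⁿ sᵏ` of the generating function at complex numbers `t`, `s`. -/
noncomputable def genTerm (t s : ℂ) (p : GenIndex) : ℂ :=
  (evenMZVSum (2 * p.1.1) p.1.2 : ℂ) * t ^ p.1.1 * s ^ p.1.2

/-- The value `F(t, s) = 1 + ∑_{n ≥ k ≥ 1} E(2n, k) tⁿ sᵏ` at complex numbers `t`, `s`. -/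
noncomputable def genFun (t s : ℂ) : ℂ := 1 + ∑' p : GenIndex, genTerm t s p

/-- The formal series `F(t, s) = 1 + ∑_{n ≥ k ≥ 1} E(2n, k) tⁿ sᵏ` in `ℝ⟦s⟧⟦t⟧`:
the outer variable is `t`, the inner one is `s`. -/
noncomputable def genSeries : ℝ⟦X⟧⟦X⟧ :=
  1 + PowerSeries.mk fun n => PowerSeries.mk fun k =>
    if 1 ≤ k ∧ k ≤ n then evenMZVSum (2 * n) k else 0

/-- The formal series `√(1 - s) = ∑ₘ (1/2 choose m) (-s)ᵐ` in `ℝ⟦s⟧`. -/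
noncomputable def sqrtOneSub : ℝ⟦X⟧ :=
  rescale (-1 : ℝ) (PowerSeries.binomialSeries ℝ (1 / 2 : ℝ))

theorem sqrtOneSub_sq : sqrtOneSub ^ 2 = 1 - X := by
  have h : PowerSeries.binomialSeries ℝ (1 / 2 : ℝ) ^ 2 = 1 + X := by
    rw [sq, ← binomialSeries_add]
    have := binomialSeries_nat (R := ℝ) (A := ℝ) 1
    norm_num at this ⊢
    exact this
  rw [sqrtOneSub, ← map_pow, h, map_add, map_one, rescale_X]
  simp [sub_eq_add_neg]

/-- The formal series `sin (π c u)` in `ℝ⟦s⟧⟦u⟧`, for `c` in `ℝ⟦s⟧`. -/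
noncomputable def sinPiMul (c : ℝ⟦X⟧) : ℝ⟦X⟧⟦X⟧ :=
  rescale (C Real.pi * c) (PowerSeries.sin ℝ⟦X⟧)

/-! Put `y_m = t / m²`. Expanding over the finite sets `{n₁ > ⋯ > n_k}` of positive integers gives
`F(t, s) = ∏ₘ (1 + s (y_m + y_m² + ⋯))`. Each factor equals `(1 - (1 - s) y_m) / (1 - y_m)`, so
`F(t, s) = P((1 - s) t) / P(t)`, where `P(z) = ∏ₘ (1 - z / m²) = sin (π √z) / (π √z)` by Euler's
product. For the formal identity, the coefficients of the powers of `t` on both sides are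
polynomials in `s` that agree at every value of `s`, because Taylor expansions are unique.
-/

section ProductOfSeries

theorem summable_norm_prod_pi {R β : Type*} [NormedCommRing R] {k : ℕ} {f : Fin k → β → R}
    (hf : ∀ i, Summable fun b => ‖f i b‖) :
    Summable fun e : Fin k → β => ‖∏ i, f i (e i)‖ := by
  induction k with
  | zero => exact .of_finite
  | succ k ih =>
    rw [← (Fin.consEquiv fun _ => β).summable_iff]
    simpa [Function.comp_def, Fin.consEquiv, Fin.prod_univ_succ] using
      (hf 0).mul_norm (ih fun i => hf i.succ)

theorem tsum_prod_pi {R β : Type*} [NormedCommRing R] [CompleteSpace R] {k : ℕ}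
    {f : Fin k → β → R} (hf : ∀ i, Summable fun b => ‖f i b‖) :
    ∑' e : Fin k → β, ∏ i, f i (e i) = ∏ i, ∑' b, f i b := by
  induction k with
  | zero => simp [tsum_fintype]
  | succ k ih =>
    have hsucc (i : Fin k) : Summable fun b => ‖f i.succ b‖ := hf i.succ
    rw [Fin.prod_univ_succ, ← ih hsucc,
      tsum_mul_tsum_of_summable_norm (hf 0) (summable_norm_prod_pi hsucc),
      ← (Fin.consEquiv fun _ => β).tsum_eq]
    simp [Fin.consEquiv, Fin.prod_univ_succ]

variable {𝕜 : Type*} [NormedField 𝕜]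

theorem hasSum_pnat_geometric {y : 𝕜} (hy : ‖y‖ < 1) :
    HasSum (fun e : ℕ+ => y ^ (e : ℕ)) (y / (1 - y)) := by
  rw [hasSum_pnat_iff_hasSum_succ (f := fun e => y ^ e)]
  simpa only [pow_succ', div_eq_mul_inv] using (hasSum_geometric_of_norm_lt_one hy).mul_left y

theorem hasSum_prod_pnat_geometric [CompleteSpace 𝕜] {k : ℕ} {y : Fin k → 𝕜}
    (hy : ∀ i, ‖y i‖ < 1) :
    HasSum (fun e : Fin k → ℕ+ => ∏ i, y i ^ (e i : ℕ)) (∏ i, y i / (1 - y i)) := by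
  have hnorm (i : Fin k) : Summable fun e : ℕ+ => ‖y i ^ (e : ℕ)‖ := by
    simpa only [norm_pow] using (hasSum_pnat_geometric (by simpa using hy i)).summable
  have htsum := tsum_prod_pi hnorm
  simp only [(hasSum_pnat_geometric (hy _)).tsum_eq] at htsum
  exact htsum ▸ (summable_norm_prod_pi hnorm).of_norm.hasSum

theorem summable_norm_div_one_sub {ι : Type*} {y : ι → 𝕜} (hy : Summable fun i => ‖y i‖) :
    Summable fun i => ‖y i / (1 - y i)‖ := by
  refine (hy.mul_left 2).of_norm_bounded_eventually ?_
  filter_upwards [hy.tendsto_cofinite_zero.eventually_le_const one_half_pos] with i hi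
  have hden : 1 / 2 ≤ ‖1 - y i‖ := by
    have := norm_sub_norm_le 1 (y i)
    rw [norm_one] at this
    linarith
  rw [norm_norm, norm_div, div_le_iff₀ (by linarith)]
  nlinarith [norm_nonneg (y i)]

theorem summable_norm_mul_div_one_sub {ι : Type*} {y : ι → 𝕜} (hy : Summable fun i => ‖y i‖)
    (s : 𝕜) : Summable fun i => ‖s * (y i / (1 - y i))‖ := by
  simpa only [norm_mul] using (summable_norm_div_one_sub hy).mul_left ‖s‖

theorem tprod_one_add_mul_tprod_one_sub [CompleteSpace 𝕜] {ι : Type*} {y : ι → 𝕜}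
    (hy : Summable fun i => ‖y i‖) (hy1 : ∀ i, y i ≠ 1) (s : 𝕜) :
    (∏' i, (1 + s * (y i / (1 - y i)))) * ∏' i, (1 - y i) = ∏' i, (1 - (1 - s) * y i) := by
  have hnum : Multipliable fun i => 1 + s * (y i / (1 - y i)) :=
    multipliable_one_add_of_summable (summable_norm_mul_div_one_sub hy s)
  have hden : Multipliable fun i => 1 - y i := by
    simpa only [sub_eq_add_neg] using
      multipliable_one_add_of_summable (f := fun i => -y i) (by simpa only [norm_neg] using hy)
  rw [← hnum.tprod_mul hden]
  refine tprod_congr fun i => ?_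
  have := sub_ne_zero.2 (hy1 i).symm
  field_simp
  ring

end ProductOfSeries

namespace MZVIndex

variable {k : ℕ}

/-- The entries `n₁ > ⋯ > n_k` of an index, as positive integers. -/
def entry (n : MZVIndex k) (j : Fin k) : ℕ+ := ⟨n.1 j, n.2.2 j⟩

theorem entry_strictAnti (n : MZVIndex k) : StrictAnti n.entry := n.2.1

theorem entry_injective (n : MZVIndex k) : Function.Injective n.entry :=
  n.entry_strictAnti.injective

/-- The finite set `{n₁, …, n_k}` underlying an index, which determines it. -/
def support (n : MZVIndex k) : Finset ℕ+ := Finset.univ.map ⟨n.entry, n.entry_injective⟩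

theorem card_support (n : MZVIndex k) : n.support.card = k := by simp [support]

theorem prod_support {M : Type*} [CommMonoid M] (f : ℕ+ → M) (n : MZVIndex k) :
    ∏ m ∈ n.support, f m = ∏ j, f (n.entry j) := by simp [support]

theorem support_injective : Function.Injective (support (k := k)) := by
  intro n m h
  have hrange : Set.range n.entry = Set.range m.entry := by
    simpa [support] using congrArg (fun S : Finset ℕ+ => (S : Set ℕ+)) h
  have hentry := (StrictAnti.range_inj n.entry_strictAnti m.entry_strictAnti).1 hrange
  exact Subtype.ext <| funext fun j => congrArg PNat.val (congrFun hentry j)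

theorem exists_support_eq (S : Finset ℕ+) : ∃ n : MZVIndex S.card, n.support = S := by
  have hanti : StrictAnti fun j => (S.orderEmbOfFin rfl (Fin.rev j) : ℕ) := fun a b hab => by
    simpa using hab
  refine ⟨⟨_, hanti, fun j => PNat.pos _⟩, Finset.coe_injective ?_⟩
  simp only [support, Finset.coe_map, Finset.coe_univ, Set.image_univ]
  exact (Fin.rev_surjective.range_comp _).trans (S.range_orderEmbOfFin rfl)

theorem support_bijective :
    Function.Bijective fun p : Σ k, MZVIndex k => p.2.support := by
  refine ⟨?_, fun S => ?_⟩
  · rintro ⟨k, n⟩ ⟨l, m⟩ (h : n.support = m.support)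
    obtain rfl : k = l := by rw [← n.card_support, h, m.card_support]
    rw [support_injective h]
  · obtain ⟨n, hn⟩ := exists_support_eq S
    exact ⟨⟨_, n⟩, hn⟩

/-- Indices of all depths correspond to finite sets of positive integers. This is what turns sums
over `n₁ > ⋯ > n_k` into expansions of infinite products. -/
noncomputable def sigmaEquivFinset : (Σ k, MZVIndex k) ≃ Finset ℕ+ :=
  Equiv.ofBijective _ support_bijective

end MZVIndex

theorem summable_pnat_inv_sq : Summable fun m : ℕ+ => ((m : ℝ) ^ 2)⁻¹ :=
  (Real.summable_nat_pow_inv.2 one_lt_two).comp_injective PNat.coe_injective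

theorem mzvTerm_eq_prod {k : ℕ} (i : Fin k → ℕ) (n : MZVIndex k) :
    mzvTerm i n = ∏ j, ((n.entry j : ℝ) ^ i j)⁻¹ := by
  rw [mzvTerm, one_div, Finset.prod_inv_distrib]
  rfl

theorem summable_mzvTerm {k : ℕ} {i : Fin k → ℕ} (hi : ∀ j, 2 ≤ i j) :
    Summable (mzvTerm i) := by
  have hfinset := summable_finsetProd_of_summable_nonneg (fun m => by positivity)
    summable_pnat_inv_sq
  refine .of_nonneg_of_le (fun n => ?_) (fun n => ?_)
    (hfinset.comp_injective MZVIndex.support_injective)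
  · rw [mzvTerm_eq_prod]
    positivity
  · rw [mzvTerm_eq_prod, Function.comp_apply, MZVIndex.prod_support]
    have hone (j : Fin k) : (1 : ℝ) ≤ n.entry j := Nat.one_le_cast.2 (n.entry j).pos
    gcongr with j
    · exact hone j
    · exact hi j

section Expansion

variable {𝕜 : Type*} [NormedField 𝕜]

/-- The general term `sᵏ y(n₁) ^ e₁ ⋯ y(n_k) ^ e_k` of the expansion of the infinite product
`∏ₘ (1 + s (y(m) + y(m)² + ⋯))`. -/
def expansionTerm (y : ℕ+ → 𝕜) (s : 𝕜) (x : Σ p : Σ k, MZVIndex k, Fin p.1 → ℕ+) : 𝕜 :=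
  s ^ x.1.1 * ∏ j, y (x.1.2.entry j) ^ (x.2 j : ℕ)

theorem norm_expansionTerm (y : ℕ+ → 𝕜) (s : 𝕜) (x : Σ p : Σ k, MZVIndex k, Fin p.1 → ℕ+) :
    ‖expansionTerm y s x‖ = expansionTerm (fun m => ‖y m‖) ‖s‖ x := by
  simp [expansionTerm, norm_prod]

variable {y : ℕ+ → 𝕜}

theorem hasSum_expansionTerm_exponents [CompleteSpace 𝕜] (hy1 : ∀ m, ‖y m‖ < 1) (s : 𝕜)
    (p : Σ k, MZVIndex k) :
    HasSum (fun e => expansionTerm y s ⟨p, e⟩) (∏ m ∈ p.2.support, s * (y m / (1 - y m))) := by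
  rw [MZVIndex.prod_support, Finset.prod_mul_distrib, Finset.prod_const, Finset.card_fin]
  exact (hasSum_prod_pnat_geometric fun j => hy1 (p.2.entry j)).mul_left (s ^ p.1)

theorem summable_norm_expansionTerm (hy : Summable fun m => ‖y m‖) (hy1 : ∀ m, ‖y m‖ < 1)
    (s : 𝕜) : Summable fun x => ‖expansionTerm y s x‖ := by
  have hexponents (p : Σ k, MZVIndex k) : HasSum (fun e => ‖expansionTerm y s ⟨p, e⟩‖)
      (∏ m ∈ p.2.support, ‖s‖ * (‖y m‖ / (1 - ‖y m‖))) := by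
    simp only [norm_expansionTerm]
    exact hasSum_expansionTerm_exponents (by simpa only [norm_norm] using hy1) ‖s‖ p
  have hfinset : Summable fun S : Finset ℕ+ => ∏ m ∈ S, ‖s‖ * (‖y m‖ / (1 - ‖y m‖)) :=
    summable_finsetProd_of_summable_norm
      (summable_norm_mul_div_one_sub (by simpa only [norm_norm] using hy) ‖s‖)
  rw [summable_sigma_of_nonneg fun _ => norm_nonneg _]
  simp only [(hexponents _).tsum_eq]
  exact ⟨fun p => (hexponents p).summable,
    hfinset.comp_injective MZVIndex.support_bijective.injective⟩

theorem hasSum_expansionTerm [CompleteSpace 𝕜] (hy : Summable fun m => ‖y m‖)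
    (hy1 : ∀ m, ‖y m‖ < 1) (s : 𝕜) :
    HasSum (expansionTerm y s) (∏' m, (1 + s * (y m / (1 - y m)))) := by
  have hsum := (summable_norm_expansionTerm hy hy1 s).of_norm.hasSum
  have hfinset : HasSum (fun S : Finset ℕ+ => ∏ m ∈ S, s * (y m / (1 - y m))) _ :=
    MZVIndex.sigmaEquivFinset.hasSum_iff.1
      (hsum.sigma (hasSum_expansionTerm_exponents hy1 s))
  rwa [tprod_one_add hfinset.summable, hfinset.tsum_eq]

end Expansion

section EvenArguments

/-- The tuple of positive even integers `(2e₁, …, 2e_k)`. -/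
def evenTuple {k : ℕ} (e : Fin k → ℕ+) (j : Fin k) : ℕ := 2 * e j

theorem evenTuple_injective {k : ℕ} : Function.Injective (evenTuple (k := k)) := fun _ _ h =>
  funext fun j => PNat.eq (Nat.eq_of_mul_eq_mul_left two_pos (congrFun h j))

theorem exists_evenTuple_eq {k : ℕ} {i : Fin k → ℕ} (hi : ∀ j, 0 < i j ∧ Even (i j)) :
    ∃ e, evenTuple e = i := by
  choose r hr using fun j => (hi j).2.two_dvd
  have hpos (j : Fin k) : 0 < r j := by
    have := (hi j).1
    have := hr j
    omega
  exact ⟨fun j => ⟨r j, hpos j⟩, funext fun j => (hr j).symm⟩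

theorem mem_evenArguments {w k : ℕ} {i : Fin k → ℕ} :
    i ∈ evenArguments w k ↔ ∑ j, i j = w ∧ ∀ j, 0 < i j ∧ Even (i j) := by
  simp [evenArguments]

theorem evenTuple_mem_evenArguments {k : ℕ} (e : Fin k → ℕ+) :
    evenTuple e ∈ evenArguments (2 * ∑ j, (e j : ℕ)) k :=
  mem_evenArguments.2 ⟨(Finset.mul_sum ..).symm,
    fun j => ⟨Nat.mul_pos two_pos (e j).pos, even_two_mul _⟩⟩

/-- Tuples of positive integers of all lengths, sorted by their sum `n` and length `k`, correspond
to tuples of positive even integers of weight `2n` and depth `k`. -/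
noncomputable def sigmaEvenArgumentsEquiv :
    (Σ k, Fin k → ℕ+) ≃ Σ p : ℕ × ℕ, evenArguments (2 * p.1) p.2 :=
  Equiv.ofBijective
    (fun q => ⟨(∑ j, (q.2 j : ℕ), q.1), evenTuple q.2, evenTuple_mem_evenArguments q.2⟩) <| by
    constructor
    · rintro ⟨k, e⟩ ⟨l, e'⟩ h
      have htuple : (⟨k, evenTuple e⟩ : Σ k, Fin k → ℕ) = ⟨l, evenTuple e'⟩ :=
        congrArg (fun x : Σ p : ℕ × ℕ, evenArguments (2 * p.1) p.2 =>
          (⟨x.1.2, x.2.1⟩ : Σ k, Fin k → ℕ)) h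
      obtain rfl : k = l := congrArg Sigma.fst htuple
      rw [evenTuple_injective (sigma_mk_injective htuple)]
    · rintro ⟨⟨n, k⟩, (i : Fin k → ℕ), hi⟩
      obtain ⟨hsum, heven⟩ := mem_evenArguments.1 hi
      obtain ⟨e, rfl⟩ : ∃ e : Fin k → ℕ+, evenTuple e = i := exists_evenTuple_eq heven
      obtain rfl : ∑ j, (e j : ℕ) = n :=
        Nat.eq_of_mul_eq_mul_left two_pos ((Finset.mul_sum ..).trans hsum)
      exact ⟨⟨k, e⟩, rfl⟩

theorem evenMZVSum_zero_zero : evenMZVSum 0 0 = 1 := by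
  have harguments : evenArguments 0 0 = Finset.univ := by
    ext i
    simpa [mem_evenArguments] using Subsingleton.elim _ _
  have : Unique (MZVIndex 0) :=
    ⟨⟨⟨![], fun j => j.elim0, fun j => j.elim0⟩⟩, fun n => Subtype.ext (Subsingleton.elim _ _)⟩
  simp [evenMZVSum, harguments, mzv, mzvTerm]

theorem evenMZVSum_eq_zero_of_lt {n k : ℕ} (h : n < k) : evenMZVSum (2 * n) k = 0 := by
  refine Finset.sum_eq_zero fun i hi => absurd ?_ h.not_ge
  obtain ⟨hsum, heven⟩ := mem_evenArguments.1 hi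
  have : ∑ _j : Fin k, 2 ≤ ∑ j, i j :=
    Finset.sum_le_sum fun j _ => Nat.le_of_dvd (heven j).1 (heven j).2.two_dvd
  rw [Fin.sum_const, smul_eq_mul, hsum] at this
  omega

theorem evenMZVSum_depth_zero {n : ℕ} (h : n ≠ 0) : evenMZVSum (2 * n) 0 = 0 := by
  refine Finset.sum_eq_zero fun i hi => absurd ?_ h
  simpa using (mem_evenArguments.1 hi).1.symm

theorem evenMZVSum_two_mul (n k : ℕ) :
    evenMZVSum (2 * n) k =
      (if n = 0 ∧ k = 0 then 1 else 0) + if 1 ≤ k ∧ k ≤ n then evenMZVSum (2 * n) k else 0 := by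
  rcases lt_or_ge n k with hnk | hkn
  · rw [if_neg (by omega), if_neg (by omega), evenMZVSum_eq_zero_of_lt hnk, add_zero]
  rcases Nat.eq_zero_or_pos k with rfl | hk
  · rcases eq_or_ne n 0 with rfl | hn
    · simp [evenMZVSum_zero_zero]
    · simp [hn, evenMZVSum_depth_zero hn]
  · rw [if_neg (by omega), if_pos ⟨hk, hkn⟩, zero_add]

end EvenArguments

section GeneratingFunction

theorem norm_div_pnat_sq (t : ℂ) (m : ℕ+) : ‖t / (m : ℂ) ^ 2‖ = ‖t‖ * ((m : ℝ) ^ 2)⁻¹ := by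
  simp [div_eq_mul_inv]

theorem norm_div_pnat_sq_lt_one {t : ℂ} (ht : ‖t‖ < 1) (m : ℕ+) : ‖t / (m : ℂ) ^ 2‖ < 1 := by
  have : (1 : ℝ) ≤ (m : ℝ) ^ 2 := one_le_pow₀ (Nat.one_le_cast.2 m.pos)
  rw [norm_div_pnat_sq]
  exact (mul_le_of_le_one_right (norm_nonneg t) (inv_le_one_of_one_le₀ this)).trans_lt ht

theorem summable_norm_div_pnat_sq (t : ℂ) : Summable fun m : ℕ+ => ‖t / (m : ℂ) ^ 2‖ := by
  simpa only [norm_div_pnat_sq] using summable_pnat_inv_sq.mul_left ‖t‖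

theorem expansionTerm_div_sq (t s : ℂ) {k : ℕ} (n : MZVIndex k) (e : Fin k → ℕ+) :
    expansionTerm (fun m => t / (m : ℂ) ^ 2) s ⟨⟨k, n⟩, e⟩ =
      t ^ (∑ j, (e j : ℕ)) * s ^ k * (mzvTerm (evenTuple e) n : ℂ) := by
  simp only [expansionTerm, mzvTerm_eq_prod, evenTuple, div_pow, Finset.prod_div_distrib,
    Finset.prod_pow_eq_pow_sum, ← pow_mul, Complex.ofReal_prod, Complex.ofReal_inv,
    Complex.ofReal_pow, Complex.ofReal_natCast, Finset.prod_inv_distrib]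
  ring

/-- Exchanges the roles of an index and an exponent tuple of the same length, so that the expansion
can be summed over the indices first. -/
def sigmaExponentsEquiv :
    (Σ q : Σ k, Fin k → ℕ+, MZVIndex q.1) ≃ Σ p : Σ k, MZVIndex k, Fin p.1 → ℕ+ where
  toFun x := ⟨⟨x.1.1, x.2⟩, x.1.2⟩
  invFun x := ⟨⟨x.1.1, x.2⟩, x.1.2⟩

theorem hasSum_mzv_evenTuple {t : ℂ} (ht : ‖t‖ < 1) (s : ℂ) :
    HasSum (fun q : Σ k, Fin k → ℕ+ =>
        t ^ (∑ j, (q.2 j : ℕ)) * s ^ q.1 * (mzv (evenTuple q.2) : ℂ))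
      (∏' m : ℕ+, (1 + s * (t / (m : ℂ) ^ 2 / (1 - t / (m : ℂ) ^ 2)))) := by
  have hexpansion := hasSum_expansionTerm (summable_norm_div_pnat_sq t)
    (norm_div_pnat_sq_lt_one ht) s
  refine (sigmaExponentsEquiv.hasSum_iff.2 hexpansion).sigma fun ⟨k, e⟩ => ?_
  have hmzv : HasSum (mzvTerm (evenTuple e)) (mzv (evenTuple e)) :=
    (summable_mzvTerm fun j => Nat.le_mul_of_pos_right 2 (e j).pos).hasSum
  exact ((Complex.hasSum_ofReal.2 hmzv).mul_left _).congr_fun fun n =>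
    expansionTerm_div_sq t s n e

theorem hasSum_evenMZVSum {t : ℂ} (ht : ‖t‖ < 1) (s : ℂ) :
    HasSum (fun p : ℕ × ℕ => (evenMZVSum (2 * p.1) p.2 : ℂ) * t ^ p.1 * s ^ p.2)
      (∏' m : ℕ+, (1 + s * (t / (m : ℂ) ^ 2 / (1 - t / (m : ℂ) ^ 2)))) := by
  have hsigma : HasSum (fun x : Σ p : ℕ × ℕ, evenArguments (2 * p.1) p.2 =>
      t ^ x.1.1 * s ^ x.1.2 * (mzv x.2.1 : ℂ)) _ :=
    sigmaEvenArgumentsEquiv.hasSum_iff.1 (hasSum_mzv_evenTuple ht s)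
  convert hsigma.sigma fun p => Finset.hasSum (evenArguments (2 * p.1) p.2)
    fun i => t ^ p.1 * s ^ p.2 * (mzv i : ℂ) using 2 with p
  rw [evenMZVSum, Complex.ofReal_sum, ← Finset.mul_sum]
  ring

theorem summable_genTerm {t : ℂ} (ht : ‖t‖ < 1) (s : ℂ) : Summable (genTerm t s) :=
  (hasSum_evenMZVSum ht s).summable.comp_injective
    (Subtype.val_injective (p := fun p : ℕ × ℕ => 1 ≤ p.2 ∧ p.2 ≤ p.1))

theorem hasSum_genFun {t : ℂ} (ht : ‖t‖ < 1) (s : ℂ) :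
    HasSum (fun p : ℕ × ℕ => (evenMZVSum (2 * p.1) p.2 : ℂ) * t ^ p.1 * s ^ p.2)
      (genFun t s) := by
  have hterm : HasSum (genTerm t s) (∑' p, genTerm t s p) := (summable_genTerm ht s).hasSum
  have htail := (hasSum_subtype_iff_indicator (s := {p : ℕ × ℕ | 1 ≤ p.2 ∧ p.2 ≤ p.1})
    (f := fun p : ℕ × ℕ => (evenMZVSum (2 * p.1) p.2 : ℂ) * t ^ p.1 * s ^ p.2)).1 hterm
  refine ((hasSum_ite_eq ((0, 0) : ℕ × ℕ) (1 : ℂ)).add htail).congr_fun fun p => ?_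
  rw [evenMZVSum_two_mul]
  simp only [Set.indicator, Set.mem_ofPred_eq, Prod.ext_iff]
  split_ifs with h0 <;> simp [h0]

theorem genFun_eq_tprod {t : ℂ} (ht : ‖t‖ < 1) (s : ℂ) :
    genFun t s = ∏' m : ℕ+, (1 + s * (t / (m : ℂ) ^ 2 / (1 - t / (m : ℂ) ^ 2))) :=
  (hasSum_genFun ht s).unique (hasSum_evenMZVSum ht s)

/-- The infinite product `∏ₘ (1 - z / m²) = sin (π √z) / (π √z)`, an entire function of `z`. -/
noncomputable def sineProduct (z : ℂ) : ℂ := ∏' m : ℕ+, (1 - z / (m : ℂ) ^ 2)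

theorem genFun_mul_sineProduct {t : ℂ} (ht : ‖t‖ < 1) (s : ℂ) :
    genFun t s * sineProduct t = sineProduct ((1 - s) * t) := by
  have hne (m : ℕ+) : t / (m : ℂ) ^ 2 ≠ 1 := fun h => by
    simpa [h] using norm_div_pnat_sq_lt_one ht m
  rw [genFun_eq_tprod ht, sineProduct,
    tprod_one_add_mul_tprod_one_sub (summable_norm_div_pnat_sq t) hne]
  simp only [mul_div_assoc, sineProduct]

theorem hasProd_sineProduct (z : ℂ) :
    HasProd (fun m : ℕ+ => 1 - z / (m : ℂ) ^ 2) (sineProduct z) := by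
  simpa only [sineProduct, sub_eq_add_neg] using (multipliable_one_add_of_summable
    (f := fun m : ℕ+ => -(z / (m : ℂ) ^ 2))
    (by simpa only [norm_neg] using summable_norm_div_pnat_sq z)).hasProd

theorem sin_pi_mul_eq (a : ℂ) :
    Complex.sin (Real.pi * a) = Real.pi * a * sineProduct (a ^ 2) := by
  have hprod := hasProd_pnat_iff_hasProd_succ (f := fun m => 1 - a ^ 2 / (m : ℂ) ^ 2) |>.1
    (hasProd_sineProduct (a ^ 2))
  refine tendsto_nhds_unique (Complex.tendsto_euler_sin_prod a) ?_
  simpa using hprod.tendsto_prod_nat.const_mul (Real.pi * a : ℂ)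

theorem sin_pi_mul_ne_zero_of_norm_lt_one {a : ℂ} (ha : ‖a‖ < 1) (ha0 : a ≠ 0) :
    Complex.sin (Real.pi * a) ≠ 0 := by
  refine sin_pi_mul_ne_zero ?_
  rintro ⟨n, rfl⟩
  rw [Complex.norm_intCast] at ha
  have hn : n = 0 := Int.abs_lt_one_iff.1 (by exact_mod_cast ha)
  simp [hn] at ha0

theorem genFun_mul_sin {t s a b : ℂ} (ht : ‖t‖ < 1) (ha : a ^ 2 = t) (hb : b ^ 2 = 1 - s) :
    genFun t s * (b * Complex.sin (Real.pi * a)) = Complex.sin (Real.pi * b * a) := by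
  rw [mul_assoc, sin_pi_mul_eq, sin_pi_mul_eq, mul_pow, ha, hb, ← genFun_mul_sineProduct ht]
  ring

theorem mul_sin_pi_ne_zero {t s a b : ℂ} (ht : ‖t‖ < 1) (ht0 : t ≠ 0) (hs : s ≠ 1)
    (ha : a ^ 2 = t) (hb : b ^ 2 = 1 - s) : b * Complex.sin (Real.pi * a) ≠ 0 := by
  have ha0 : a ≠ 0 := ne_zero_pow two_ne_zero (ha ▸ ht0)
  have hb0 : b ≠ 0 := ne_zero_pow two_ne_zero (hb ▸ sub_ne_zero.2 hs.symm)
  have ha1 : ‖a‖ < 1 := by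
    rwa [← ha, norm_pow, pow_lt_one_iff_of_nonneg (norm_nonneg _) two_ne_zero] at ht
  exact mul_ne_zero hb0 (sin_pi_mul_ne_zero_of_norm_lt_one ha1 ha0)

end GeneratingFunction

section PowerSeriesEvaluation

theorem hasSum_coeff_mul {R : Type*} [NormedCommRing R] [CompleteSpace R] {f g : R⟦X⟧} {z a b : R}
    (hf : HasSum (fun n => coeff n f * z ^ n) a) (hg : HasSum (fun n => coeff n g * z ^ n) b)
    (hf' : Summable fun n => ‖coeff n f * z ^ n‖) (hg' : Summable fun n => ‖coeff n g * z ^ n‖) :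
    HasSum (fun n => coeff n (f * g) * z ^ n) (a * b) := by
  rw [← hf.tsum_eq, ← hg.tsum_eq, tsum_mul_tsum_eq_tsum_sum_antidiagonal_of_summable_norm hf' hg']
  refine (summable_norm_sum_mul_antidiagonal_of_summable_norm hf' hg').of_norm.hasSum.congr_fun
    fun n => ?_
  rw [coeff_mul, Finset.sum_mul]
  refine Finset.sum_congr rfl fun p hp => ?_
  rw [← Finset.HasAntidiagonal.mem_antidiagonal.1 hp, pow_add]
  ring

theorem hasSum_coeff_rescale {R : Type*} [CommSemiring R] [TopologicalSpace R] {f : R⟦X⟧}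
    {c z a : R} (hf : HasSum (fun n => coeff n f * (c * z) ^ n) a) :
    HasSum (fun n => coeff n (rescale c f) * z ^ n) a :=
  hf.congr_fun fun n => by rw [coeff_rescale, mul_pow]; ring

theorem eq_of_eventually_hasSum_coeff {𝕜 : Type*} [NontriviallyNormedField 𝕜] {f g : 𝕜⟦X⟧}
    {F : 𝕜 → 𝕜} (hf : ∀ᶠ z in nhds 0, HasSum (fun n => coeff n f * z ^ n) (F z))
    (hg : ∀ᶠ z in nhds 0, HasSum (fun n => coeff n g * z ^ n) (F z)) : f = g := by
  have hseries (h : 𝕜⟦X⟧) (hh : ∀ᶠ z in nhds 0, HasSum (fun n => coeff n h * z ^ n) (F z)) :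
      HasFPowerSeriesAt F (FormalMultilinearSeries.ofScalars 𝕜 fun n => coeff n h) 0 := by
    rw [hasFPowerSeriesAt_iff]
    simpa [FormalMultilinearSeries.coeff_ofScalars, mul_comm] using hh
  have hcoeff := FormalMultilinearSeries.ofScalars_series_injective 𝕜 𝕜
    ((hseries f hf).eq_formalMultilinearSeries (hseries g hg))
  exact PowerSeries.ext (congrFun hcoeff)

theorem rescale_expand {R : Type*} [CommRing R] (p : ℕ) (hp : p ≠ 0) (c : R) (f : R⟦X⟧) :
    rescale c (PowerSeries.expand p hp f) = PowerSeries.expand p hp (rescale (c ^ p) f) := by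
  ext n
  rw [coeff_rescale, coeff_expand, coeff_expand]
  split_ifs with hdvd
  · rw [coeff_rescale, ← pow_mul, Nat.mul_div_cancel' hdvd]
  · rw [mul_zero]

end PowerSeriesEvaluation

section SineSeries

/-- The power series `S(z) = sin (π √z) / √z`, characterised by `sin (π u) = u S(u²)`. -/
noncomputable def sinSqrtSeries : ℝ⟦X⟧ :=
  PowerSeries.mk fun j => (-1) ^ j * Real.pi ^ (2 * j + 1) / (2 * j + 1).factorial

theorem hasSum_sinSqrtSeries (z : ℂ) :
    HasSum (fun j => coeff j (map Complex.ofRealHom sinSqrtSeries) * z ^ j)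
      (Real.pi * sineProduct z) := by
  obtain ⟨a, rfl⟩ := IsAlgClosed.exists_pow_nat_eq z two_pos
  rcases eq_or_ne a 0 with rfl | ha
  · have hzero : coeff 0 (map Complex.ofRealHom sinSqrtSeries) = Real.pi := by
      simp [sinSqrtSeries]
    simpa only [zero_pow two_ne_zero, sineProduct, zero_div, sub_zero, tprod_one, mul_one, pow_zero,
      hzero] using
      hasSum_single (f := fun j => coeff j (map Complex.ofRealHom sinSqrtSeries) * (0 : ℂ) ^ j)
        0 fun j hj => by simp [hj]
  · have hsin := (Complex.hasSum_sin (Real.pi * a)).div_const a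
    rw [sin_pi_mul_eq, mul_right_comm, mul_div_cancel_right₀ _ ha] at hsin
    refine hsin.congr_fun fun j => ?_
    simp only [sinSqrtSeries, coeff_map, coeff_mk, Complex.ofRealHom_eq_coe]
    push_cast
    field_simp
    ring

theorem rescale_pi_sin :
    rescale Real.pi (PowerSeries.sin ℝ) = X * PowerSeries.expand 2 two_ne_zero sinSqrtSeries := by
  ext n
  rcases n with _ | n
  · simp [PowerSeries.sin]
  rw [coeff_rescale, coeff_succ_X_mul, coeff_expand, PowerSeries.sin, coeff_mk]
  rcases Nat.even_or_odd' n with ⟨j, rfl | rfl⟩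
  · have hhalf : (2 * j + 1) / 2 = j := by omega
    simp only [Nat.not_even_bit1, ↓reduceIte, hhalf, map_div₀, eq_ratCast, Rat.cast_pow,
      Rat.cast_neg, Rat.cast_one, map_natCast, dvd_mul_right, ne_eq, OfNat.ofNat_ne_zero,
      not_false_eq_true, mul_div_cancel_left₀, sinSqrtSeries, coeff_mk]
    ring
  · simp [parity_simps]

theorem sinPiMul_eq (c : ℝ⟦X⟧) :
    sinPiMul c = C c * (X * PowerSeries.expand 2 two_ne_zero
      (rescale (c ^ 2) (map C sinSqrtSeries))) := by
  rw [sinPiMul, ← rescale_rescale, ← map_sin C, rescale_map, rescale_pi_sin, map_mul, map_mul,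
    map_X, rescale_X, map_expand, rescale_expand, mul_assoc]

theorem sinPiMul_ne_zero {c : ℝ⟦X⟧} (hc : c ≠ 0) : sinPiMul c ≠ 0 := by
  intro h
  have hcoeff : coeff 1 (sinPiMul c) = C Real.pi * c := by
    simp [sinPiMul, PowerSeries.sin, coeff_rescale]
  rw [h, map_zero] at hcoeff
  exact mul_ne_zero ((map_ne_zero_iff C C_injective).2 Real.pi_ne_zero) hc hcoeff.symm

theorem sqrtOneSub_ne_zero : sqrtOneSub ≠ 0 := by
  intro h
  have hcoeff := congrArg (coeff 0) sqrtOneSub_sq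
  simp [h] at hcoeff

end SineSeries

section FormalIdentity

theorem coeff_coeff_genSeries (n k : ℕ) : coeff k (coeff n genSeries) = evenMZVSum (2 * n) k := by
  rw [evenMZVSum_two_mul, genSeries, map_add, map_add, coeff_mk, coeff_mk, coeff_one]
  split_ifs with hn hnk hnk <;> simp_all [coeff_one]

/-- The polynomial `∑ₖ E(2n, k) sᵏ`, the coefficient of `tⁿ` in the generating function. -/
noncomputable def genPolynomial (n : ℕ) : Polynomial ℝ :=
  trunc (n + 1) (coeff n genSeries)

theorem coe_genPolynomial (n : ℕ) : (genPolynomial n : ℝ⟦X⟧) = coeff n genSeries := by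
  ext k
  rw [Polynomial.coeff_coe, genPolynomial, coeff_trunc, coeff_coeff_genSeries]
  split_ifs with hk
  · rfl
  · exact (evenMZVSum_eq_zero_of_lt (by omega)).symm

theorem eval₂_genPolynomial (s : ℂ) (n : ℕ) :
    (genPolynomial n).eval₂ Complex.ofRealHom s =
      ∑ k ∈ Finset.range (n + 1), (evenMZVSum (2 * n) k : ℂ) * s ^ k := by
  simp [genPolynomial, eval₂_trunc_eq_sum_range, coeff_coeff_genSeries]

theorem hasSum_eval₂_genPolynomial {t : ℂ} (ht : ‖t‖ < 1) (s : ℂ) :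
    HasSum (fun n => (genPolynomial n).eval₂ Complex.ofRealHom s * t ^ n) (genFun t s) := by
  refine (hasSum_genFun ht s).prod_fiberwise fun n => ?_
  rw [eval₂_genPolynomial, Finset.sum_mul]
  simp only [mul_right_comm _ (s ^ _)]
  refine hasSum_sum_of_ne_finset_zero fun k hk => ?_
  rw [evenMZVSum_eq_zero_of_lt (by simpa [Nat.lt_succ_iff] using hk)]
  simp

/-- The generating function as a power series in `t` with coefficients in `ℝ[s]`. Unlike the
elements of `ℝ⟦s⟧`, these coefficients can be evaluated at every `s`. -/
noncomputable def genPolynomialSeries : (Polynomial ℝ)⟦X⟧ := PowerSeries.mk genPolynomial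

theorem map_coe_genPolynomialSeries :
    map Polynomial.coeToPowerSeries.ringHom genPolynomialSeries = genSeries := by
  ext1 n
  simpa [genPolynomialSeries] using coe_genPolynomial n

theorem map_eval₂_genPolynomialSeries_mul (s : ℂ) :
    map (Polynomial.eval₂RingHom Complex.ofRealHom s)
        (genPolynomialSeries * map Polynomial.C sinSqrtSeries) =
      map (Polynomial.eval₂RingHom Complex.ofRealHom s)
        (rescale (1 - Polynomial.X) (map Polynomial.C sinSqrtSeries)) := by
  have hX : Polynomial.eval₂RingHom Complex.ofRealHom s (1 - Polynomial.X) = 1 - s := by simp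
  have hC : map (Polynomial.eval₂RingHom Complex.ofRealHom s) (map Polynomial.C sinSqrtSeries) =
      map Complex.ofRealHom sinSqrtSeries := by
    ext
    simp
  rw [map_mul, ← rescale_map, hC, hX]
  refine eq_of_eventually_hasSum_coeff (F := fun t => Real.pi * sineProduct ((1 - s) * t)) ?_
    (.of_forall fun t => hasSum_coeff_rescale (hasSum_sinSqrtSeries _))
  filter_upwards [Metric.ball_mem_nhds (0 : ℂ) one_pos] with t ht
  rw [mem_ball_zero_iff] at ht
  have hgen : HasSum (fun n => coeff n (map (Polynomial.eval₂RingHom Complex.ofRealHom s)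
      genPolynomialSeries) * t ^ n) (genFun t s) := by
    simpa [genPolynomialSeries] using hasSum_eval₂_genPolynomial ht s
  have hsin := hasSum_sinSqrtSeries t
  rw [← genFun_mul_sineProduct ht, mul_left_comm]
  exact hasSum_coeff_mul hgen hsin hgen.summable.norm hsin.summable.norm

theorem genPolynomialSeries_mul :
    genPolynomialSeries * map Polynomial.C sinSqrtSeries =
      rescale (1 - Polynomial.X) (map Polynomial.C sinSqrtSeries) := by
  ext1 n
  refine Polynomial.funext fun s => Complex.ofReal_injective ?_
  have heval (p : Polynomial ℝ) : ((p.eval s : ℝ) : ℂ) = p.eval₂ Complex.ofRealHom s :=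
    (Polynomial.eval₂_at_apply Complex.ofRealHom s).symm
  rw [heval, heval]
  exact congrArg (coeff n) (map_eval₂_genPolynomialSeries_mul s)

theorem genSeries_mul :
    genSeries * map C sinSqrtSeries = rescale (1 - X) (map C sinSqrtSeries) := by
  have hX : Polynomial.coeToPowerSeries.ringHom (1 - Polynomial.X : Polynomial ℝ) = 1 - X := by
    simp
  have hC : map Polynomial.coeToPowerSeries.ringHom (map Polynomial.C sinSqrtSeries) =
      map C sinSqrtSeries := by
    ext1
    simp
  rw [← hC, ← map_coe_genPolynomialSeries, ← map_mul, genPolynomialSeries_mul, ← rescale_map, hX]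

theorem expand_genSeries_mul :
    PowerSeries.expand 2 two_ne_zero genSeries * (C sqrtOneSub * sinPiMul 1) =
      sinPiMul sqrtOneSub := by
  rw [sinPiMul_eq, sinPiMul_eq, sqrtOneSub_sq, ← genSeries_mul, one_pow, rescale_one, map_mul,
    map_one, RingHom.id_apply]
  ring

end FormalIdentity

/-- The three parts: the multiple zeta series occurring in the coefficients converge; the
identity holds in the formal power series domain `ℝ⟦s⟧⟦u⟧`, where `t = u ^ 2`, so `u = √t`;
and it holds, with convergence, for complex `|t| < 1`, for every choice `a` of `√t` and `b` of
`√(1 - s)`, wherever the right hand side has a nonzero denominator. -/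
theorem theorem2 :
    (∀ (k : ℕ) (i : Fin k → ℕ), (∀ j, 0 < i j ∧ Even (i j)) → Summable (mzvTerm i)) ∧
    (C sqrtOneSub * sinPiMul 1 ≠ 0 ∧
      PowerSeries.expand 2 two_ne_zero genSeries * (C sqrtOneSub * sinPiMul 1) =
        sinPiMul sqrtOneSub) ∧
    (∀ t s : ℂ, ‖t‖ < 1 → Summable (genTerm t s)) ∧
    (∀ t s a b : ℂ, ‖t‖ < 1 → t ≠ 0 → s ≠ 1 → a ^ 2 = t → b ^ 2 = 1 - s →
      b * Complex.sin (Real.pi * a) ≠ 0 ∧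
      genFun t s = Complex.sin (Real.pi * b * a) / (b * Complex.sin (Real.pi * a))) := by
  refine ⟨fun k i hi => summable_mzvTerm fun j => Nat.le_of_dvd (hi j).1 (hi j).2.two_dvd,
    ⟨mul_ne_zero ?_ (sinPiMul_ne_zero one_ne_zero), expand_genSeries_mul⟩,
    fun t s ht => summable_genTerm ht s, fun t s a b ht ht0 hs ha hb => ?_⟩
  · exact (map_ne_zero_iff C C_injective).2 sqrtOneSub_ne_zero
  · have hden := mul_sin_pi_ne_zero ht ht0 hs ha hb
    exact ⟨hden, eq_div_of_mul_eq hden (genFun_mul_sin ht ha hb)⟩
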